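/- **Model.** Let $N,T\ge 1$ and $K\ge 0$ be integers. Sources $n=1,\dots,N$ have independent two-state Markov chains $X_n(t)\in\{0,1\}$, $t=0,\dots,T$ ($1$ = free, $0$ = busy), with $\Pr(0\to1)=\mu_n$ and $\Pr(1\to0)=\lambda_n$, where $0\le\mu_n,\lambda_n<\tfrac12$ and $\mu_n+\lambda_n>0$, started from the stationary law $\Pr(X_n(0)=1)=\mu_n/(\mu_n+\lambda_n)$. At each time $t=1,\dots,T$ source $n$ chooses $U_n(t)\in\{0,1\}$ (possibly at random) from its own history $X_n(0),\dots,X_n(t)$, $U_n(1),\dots,U_n(t-1)$, and $U_n(0)=0$. The value monitored at the destination is $Y_n(t+1)=X_n(t)$ if $U_n(t)=1$ and $Y_n(t+1)=Y_n(t)$ otherwise, where $Y_n(0)$ is a given function of $X_n(0)$. Put $$\alpha_n=\Pr\Big(\sum_{j<n}X_j(0)<K\Big),\qquad \beta_n(t)=\Pr\big(X_n(t)\ne Y_n(t)\big),\qquad \rho(t)=\min_{1\le m\le N}\Big(\alpha_m+\sum_{n=1}^{m-1}\alpha_n\beta_n(t)\Big).$$ **Theorem.** There is an absolute constant $C$ such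 that the following holds for all such $N,T,K,\mu_n,\lambda_n,Y_n(0)$ and all $r>0$. The minimum of $\frac1T\sum_{t=1}^T\rho(t)$ over all update policies with $\frac1T\sum_{n=1}^N\sum_{t=1}^T\mathbb E[U_n(t)]\le r$ is attained; and if $U$ is a policy attaining it, with surrogate errors $\rho(t)$, then there are integers $0\le T_n\le T$, $n=1,\dots,N$, such that the policy $$\tilde U_n(t)=\begin{cases}1 & t\le T_n \text{ and } (X_n(t),\tilde Y_n(t))\in\{(0,1),(1,0)\},\\ 1 & t>T_n,\ (X_n(t),\tilde Y_n(t))=(0,1) \text{ and } \lambda_n\ge\mu_n,\\ 1 & t>T_n,\ (X_n(t),\tilde Y_n(t))=(1,0) \text{ and } \mu_n>\lambda_n,\\ 0&\text{otherwise,}\end{cases}$$ where $\tilde Y_n$ denotes the monitored value under $\tilde U$ and $\tilde\rho(t)$ the surrogate error of $\tilde U$, satisfies $$\frac1T\sum_{t=1}^T\tilde\rho(t)\le\frac1T\sum_{t=1}^T\rho(t)+C\,\frac NT\qquad\text{and}\qquad \frac1T\sum_{n=1}^N\sum_{t=1}^T\mathbb E[\tilde U_n(t)]\le r+C\,\frac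 NT .$$ -/

import Mathlib

open scoped BigOperators

noncomputable section

/-- Parameters of a flat network with `N` two-state remote sources (`true` = free = 1,
`false` = busy = 0), listed in order of preference.  The destination wants the `K` most preferred
free sources.  `start n` gives the monitored value at time `0` as a function of the state of
source `n` at time `0` (for instance the identity, or a constant). -/
structure Network (N : ℕ) where
  K : ℕ
  /-- probability of a transition from busy to free -/
  mu : Fin N → ℝ
  /-- probability of a transition from free to busy -/
  lam : Fin N → ℝ
  mu_nonneg : ∀ n, 0 ≤ mu n
  lam_nonneg : ∀ n, 0 ≤ lam n
  mu_lt : ∀ n, mu n < 1 / 2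
  lam_lt : ∀ n, lam n < 1 / 2
  /-- needed for the stationary law to be well defined -/
  zeta_pos : ∀ n, 0 < mu n + lam n
  start : Fin N → Bool → Bool

/-- Trajectory of one source over the times `0, …, T`: the pair at time `t` is `(X(t), U(t))`,
the state and whether the source reports. -/
abbrev Traj (T : ℕ) : Type := Fin (T + 1) → Bool × Bool

/-- A (randomized, history-dependent) update policy of one source: for each time `t`, the past
`(X(i), U(i))`, `i < t`, and the current state `X(t)`, the probability of reporting at time `t`.
Only the values at times `t ≥ 1` are ever used. -/
abbrev SourcePolicy : Type :=
  (t : ℕ) → (Fin t → Bool × Bool) → Bool → unitInterval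

/-- An update policy of the network; each source uses its own history only. -/
abbrev UpdatePolicy (N : ℕ) : Type := Fin N → SourcePolicy

/-- Bernoulli weights: `true` has probability `p`. -/
def bern (p : ℝ) (b : Bool) : ℝ := if b then p else 1 - p

/-- The monitored value `Y(t)`, as a function of `(X(i), U(i))`, `i < t`, and of `X(t)` (the latter
matters only for `t = 0`): `Y(t + 1) = X(t)` if `U(t) = 1`, and `Y(t + 1) = Y(t)` otherwise. -/
def monitored (start : Bool → Bool) : (t : ℕ) → (Fin t → Bool × Bool) → Bool → Bool
  | 0, _, x => start x
  | t + 1, h, _ =>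
    if (h (Fin.last t)).2 then (h (Fin.last t)).1
    else monitored start t (Fin.init h) (h (Fin.last t)).1

namespace Network

variable {N : ℕ}

/-- Stationary probability of the state `a` of source `n`. -/
def stat (S : Network N) (n : Fin N) (a : Bool) : ℝ :=
  bern (S.mu n / (S.mu n + S.lam n)) a

/-- Probability that source `n` moves from state `b` to state `a`. -/
def trans (S : Network N) (n : Fin N) (b a : Bool) : ℝ :=
  bern (if b then 1 - S.lam n else S.mu n) a

/-- Probability of a trajectory of source `n` under the policy `p`: `X` is the stationary Markov
chain, there is no report at time `0`, and the report at time `t + 1` is decided after the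
transition, from the history of this source. -/
def pathWeight (S : Network N) (n : Fin N) (p : SourcePolicy) : (T : ℕ) → Traj T → ℝ
  | 0, ω => S.stat n (ω 0).1 * bern 0 (ω 0).2
  | T + 1, ω =>
    S.pathWeight n p T (Fin.init ω)
      * S.trans n (ω (Fin.last T).castSucc).1 (ω (Fin.last (T + 1))).1
      * bern (p (T + 1) (Fin.init ω) (ω (Fin.last (T + 1))).1) (ω (Fin.last (T + 1))).2

/-- Expectation over the trajectories of all sources, which evolve independently. -/
def expect (S : Network N) (T : ℕ) (U : UpdatePolicy N) (f : (Fin N → Traj T) → ℝ) : ℝ :=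
  ∑ ω : Fin N → Traj T, (∏ n, S.pathWeight n (U n) T (ω n)) * f ω

open Classical in
/-- Probability of an event. -/
def prob (S : Network N) (T : ℕ) (U : UpdatePolicy N) (E : (Fin N → Traj T) → Prop) : ℝ :=
  S.expect T U (fun ω => if E ω then 1 else 0)

/-- The state `X_n(t)`. -/
def X {T : ℕ} (n : Fin N) (t : Fin (T + 1)) (ω : Fin N → Traj T) : Bool := (ω n t).1

/-- The report indicator `U_n(t)`, as a real number. -/
def report {T : ℕ} (n : Fin N) (t : Fin (T + 1)) (ω : Fin N → Traj T) : ℝ :=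
  if (ω n t).2 then 1 else 0

/-- The monitored value `Y_n(t)`. -/
def Y (S : Network N) {T : ℕ} (n : Fin N) (t : Fin (T + 1)) (ω : Fin N → Traj T) : Bool :=
  monitored (S.start n) t (fun i => ω n (i.castLE t.isLt.le)) (ω n t).1

/-- `α_n`: the probability that fewer than `K` of the sources preferred to `n` are free at
time `0`. -/
def alpha (S : Network N) (T : ℕ) (U : UpdatePolicy N) (n : Fin N) : ℝ :=
  S.prob T U (fun ω => (Finset.univ.filter (fun j : Fin N => j < n ∧ X j 0 ω = true)).card < S.K)

/-- `β_n(t)`: the probability that the state and the monitored value differ. -/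
def beta (S : Network N) (T : ℕ) (U : UpdatePolicy N) (n : Fin N) (t : Fin (T + 1)) : ℝ :=
  S.prob T U (fun ω => X n t ω ≠ S.Y n t ω)

/-- The surrogate error `ρ(t) = min_m (α_m + ∑_{n < m} α_n β_n(t))`. -/
def rho (S : Network N) (T : ℕ) (U : UpdatePolicy N) (t : Fin (T + 1)) : ℝ :=
  ⨅ m : Fin N, (S.alpha T U m + ∑ n ∈ Finset.univ.filter (· < m), S.alpha T U n * S.beta T U n t)

/-- Time-averaged surrogate error over the times `1, …, T`. -/
def avgRho (S : Network N) (T : ℕ) (U : UpdatePolicy N) : ℝ :=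
  (1 / (T : ℝ)) * ∑ t : Fin T, S.rho T U t.succ

/-- Update rate over the times `1, …, T`. -/
def rate (S : Network N) (T : ℕ) (U : UpdatePolicy N) : ℝ :=
  (1 / (T : ℝ)) * ∑ n : Fin N, ∑ t : Fin T, S.expect T U (report n t.succ)

/-- `U` minimizes the time-averaged surrogate error among all policies of update rate at most
`r`. -/
def IsOptimal (S : Network N) (T : ℕ) (r : ℝ) (U : UpdatePolicy N) : Prop :=
  S.rate T U ≤ r ∧ ∀ V : UpdatePolicy N, S.rate T V ≤ r → S.avgRho T U ≤ S.avgRho T V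

open Classical in
/-- The threshold policy: up to time `τ n` source `n` reports in both mismatch states; later it
reports only when `X = 0`, `Y = 1` if `μ_n ≤ λ_n`, and only when `X = 1`, `Y = 0` if
`λ_n < μ_n`. -/
def thresholdPolicy (S : Network N) (τ : Fin N → ℕ) : UpdatePolicy N := fun n t h x =>
  let y := monitored (S.start n) t h x
  if (t ≤ τ n ∧ x ≠ y)
      ∨ (τ n < t ∧ (x = false ∧ y = true) ∧ S.mu n ≤ S.lam n)
      ∨ (τ n < t ∧ (x = true ∧ y = false) ∧ S.lam n < S.mu n)
  then 1 else 0

end Network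

end

/-!
Neither the dynamics of the sources nor the budget couples two sources except through the level
`m` attaining the minimum in `ρ(t)`.  Let `m(t)` be such a level for the given policy `U`.  Then
`∑ₜ ρ(t) = ∑ₜ α_{m(t)} + ∑ₙ αₙ ∑_{t ∈ Aₙ} βₙ(t)` with `Aₙ = {t | n < m(t)}`
(`Network.sum_cutoff_eq`).  Sorting the levels in decreasing order turns every `Aₙ` into an initial
segment of the same length, so, as `αₙ ∈ [0, 1]` does not depend on the policy, it suffices to
compare, for one source and an arbitrary set `A` of times, the given policy on `A` with a threshold
policy on the first `#A` times (`Network.exists_threshold_comparison`).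

For one source let `s` be the minority state, entered with probability `p` and left with probability
`q ≥ p`, and let `π` be its stationary probability.  Two lower bounds hold for every policy:
each mismatch probability is at least `2 q π`, and, with the price `θ = 1 / (2 q) - 1` per report, the
mismatches over `A` plus `θ` times the expected number of reports, increased by `2`, are at least
`#A * π` (`MismatchFlow.saving_le`).  The second one is linear programming duality for the masses
`c` and `b` of the events `X = Y = s` and `X ≠ s, Y = s`; the dual variables are given by a backward
recursion, and the point is a region of dual variables that is stable for every `A`.
A threshold policy attains both bounds up to constants: up to the threshold it has mismatch
probability and report rate `2 q π`, and afterwards mismatch probability about `π` with at most one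
more expected report (`MismatchFlow.sum_mismatch_and_cost_le`).  The threshold is therefore `#A` if
the budget of the source permits this, and otherwise the first one at which the reports exceed the
budget by `2`, which pays for the loss `2 θ` in the dual bound.

An optimal policy exists because the policies form a compact space on which the update rate and the
surrogate error are continuous.
-/

noncomputable section

/-! ### Flow of the mass carried by one monitored value -/

/-- The part of the law of a single source that matters.  Fix a state `s` of the source, entered
with probability `p` and left with probability `q`, of stationary probability `π`.  At time `t`,
`c t` and `b t` are the probabilities that the monitored value is `s` and the source is in `s`,
respectively not in `s`, before the report; `c' t` and `b' t` are the same probabilities after the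
report, and `u t` is the probability of a report.  The probability of a mismatch before the report
is then `π - c t + b t`. -/
structure MismatchFlow (p q π : ℝ) (c b c' b' u : ℕ → ℝ) : Prop where
  c_succ : ∀ t, c (t + 1) = (1 - q) * c' t + p * b' t
  b_succ : ∀ t, b (t + 1) = q * c' t + (1 - p) * b' t
  c'_nonneg : ∀ t, 0 ≤ c' t
  b'_nonneg : ∀ t, 0 ≤ b' t
  c_nonneg : ∀ t, 0 ≤ c t
  c'_le : ∀ t, c' t ≤ π
  mass_le : ∀ t, c' t + b' t ≤ 1
  mismatch_le : ∀ t, π - c t + b t ≤ 1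
  c_le_c' : ∀ t, c t ≤ c' t
  b'_le_b : ∀ t, b' t ≤ b t
  cost : ∀ t, (c' t - c t) + (b t - b' t) ≤ u t

namespace MismatchFlow

variable {p q π : ℝ} {c b c' b' u : ℕ → ℝ}

lemma two_mul_le_mismatch (h : MismatchFlow p q π c b c' b' u) (hp : p < 1 / 2) (hq : q < 1 / 2)
    (t : ℕ) : 2 * (q * π) ≤ π - c (t + 1) + b (t + 1) := by
  rw [h.c_succ, h.b_succ]
  nlinarith [mul_nonneg (by linarith : (0 : ℝ) ≤ 1 - 2 * q) (sub_nonneg.2 (h.c'_le t)),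
    mul_nonneg (by linarith : (0 : ℝ) ≤ 1 - 2 * p) (h.b'_nonneg t)]

/-- Lagrangian duality, with a family of terminal rewards.  Compared with the monitored value
being frozen at the majority state, time `t` saves `c t - b t` (weighted by `I t`), and a report
is charged the price `θ`.  The pair `(w, v)` is the reward collected at the end on the masses
`c'` and `b'`; the condition `p * (w - θ) + q * (v + θ) ≤ 0` is stable under the backward
dynamic programming recursion, whatever the weights `I t ∈ [0, 1]` are. -/
lemma saving_add_terminal_le (h : MismatchFlow p q π c b c' b' u) {θ : ℝ} (hp : 0 ≤ p)
    (hpq : p ≤ q) (hq : q < 1 / 2) (hθ : 2 * q * θ = 1 - 2 * q) (hθ0 : 0 ≤ θ)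
    (I : ℕ → ℝ) (hI0 : ∀ t, 0 ≤ I t) (hI1 : ∀ t, I t ≤ 1) (T : ℕ) :
    ∀ w v : ℝ, w ≤ θ → -θ ≤ w → v ≤ θ → -θ ≤ v → p * (w - θ) + q * (v + θ) ≤ 0 →
      ∑ t ∈ Finset.range T, I (t + 1) * (c (t + 1) - b (t + 1))
        - θ * ∑ t ∈ Finset.range T, u (t + 1) + (w * c' T + v * b' T) ≤ θ := by
  induction T with
  | zero =>
    intro w v hw _ hv _ _
    have := h.mass_le 0
    have h1 := mul_le_mul_of_nonneg_right hw (h.c'_nonneg 0)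
    have h2 := mul_le_mul_of_nonneg_right hv (h.b'_nonneg 0)
    simp only [Finset.range_zero, Finset.sum_empty]
    nlinarith
  | succ T ih =>
    intro w v hw hw' hv hv' hR
    have i0 := hI0 (T + 1)
    have i1 := hI1 (T + 1)
    set i := I (T + 1) with hi
    set w₁ := (1 - q) * (i + w) + q * (v - i) with hw₁
    set v₁ := (1 - p) * (v - i) + p * (w + i) with hv₁
    have hq0 : 0 ≤ q := hp.trans hpq
    have hiq : i * (1 - 2 * q) ≤ 1 - 2 * q := by nlinarith
    have hiq0 : 0 ≤ i * (1 - 2 * q) := mul_nonneg i0 (by linarith)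
    have hip0 : 0 ≤ i * (1 - 2 * p) := mul_nonneg i0 (by linarith)
    have hw₁le : w₁ ≤ θ := by
      -- `w₁ - θ ≤ (1 - q) (w - θ) + q (v + θ)`, and `p ≤ 1 - q`
      have : (1 - q - p) * (w - θ) ≤ 0 :=
        mul_nonpos_of_nonneg_of_nonpos (by linarith) (by linarith)
      nlinarith
    have hw₁ge : -θ ≤ w₁ := by
      have := mul_nonneg (by linarith : (0 : ℝ) ≤ 1 - q) (by linarith : 0 ≤ w + θ)
      have := mul_nonneg hq0 (by linarith : 0 ≤ v + θ)
      nlinarith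
    have hv₁le : v₁ ≤ θ := by
      have := mul_nonneg (by linarith : (0 : ℝ) ≤ 1 - p) (by linarith : 0 ≤ θ - v)
      have := mul_nonneg hp (by linarith : 0 ≤ θ - w)
      nlinarith
    have hR₁ : p * (w₁ - θ) + q * (v₁ + θ) ≤ 0 := by
      -- the recursion preserves `p w + q v` up to the nonpositive drift `i (p - q)`
      have : p * w₁ + q * v₁ = p * w + q * v + i * (p - q) := by rw [hw₁, hv₁]; ring
      nlinarith [mul_nonneg i0 (sub_nonneg.2 hpq)]
    have key := ih w₁ (max v₁ (-θ)) hw₁le hw₁ge (max_le hv₁le (by linarith)) (le_max_right _ _)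
      (by
        rcases le_total v₁ (-θ) with hc | hc
        · rw [max_eq_right hc]
          nlinarith
        · rw [max_eq_left hc]
          exact hR₁)
    rw [Finset.sum_range_succ, Finset.sum_range_succ]
    have e1 : w₁ * c' T + v₁ * b' T ≤ w₁ * c' T + max v₁ (-θ) * b' T := by
      have := mul_le_mul_of_nonneg_right (le_max_left v₁ (-θ)) (h.b'_nonneg T)
      linarith
    have e2 : w₁ * c' T + v₁ * b' T
        = i * (c (T + 1) - b (T + 1)) + (w * c (T + 1) + v * b (T + 1)) := by
      rw [h.c_succ, h.b_succ, hw₁, hv₁]; ring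
    have e3 : w * (c' (T + 1) - c (T + 1)) ≤ θ * (c' (T + 1) - c (T + 1)) :=
      mul_le_mul_of_nonneg_right hw (sub_nonneg.2 (h.c_le_c' _))
    have e4 : -θ * (b (T + 1) - b' (T + 1)) ≤ v * (b (T + 1) - b' (T + 1)) :=
      mul_le_mul_of_nonneg_right hv' (sub_nonneg.2 (h.b'_le_b _))
    have e5 := mul_le_mul_of_nonneg_left (h.cost (T + 1)) hθ0
    nlinarith

/-- A report saves at most `θ = 1 / (2 q) - 1` mismatches: an excursion to the minority state costs
two reports and lasts `1 / q` steps on average, of which one is a mismatch anyway, and one more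
mismatch occurs at its end. -/
lemma saving_le (h : MismatchFlow p q π c b c' b' u) {θ : ℝ} (hp : 0 ≤ p)
    (hpq : p ≤ q) (hq : q < 1 / 2) (hθ : 2 * q * θ = 1 - 2 * q) (hθ0 : 0 ≤ θ)
    (I : ℕ → ℝ) (hI0 : ∀ t, 0 ≤ I t) (hI1 : ∀ t, I t ≤ 1) (T : ℕ) :
    ∑ t ∈ Finset.range T, I (t + 1) * (c (t + 1) - b (t + 1))
      ≤ θ * (∑ t ∈ Finset.range T, u (t + 1) + 2) := by
  -- `(θ, -θ)` is an extreme point of the stable region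
  have key := h.saving_add_terminal_le hp hpq hq hθ hθ0 I hI0 hI1 T θ (-θ) le_rfl (by linarith)
    (by linarith) le_rfl (by linarith)
  have h1 := mul_nonneg hθ0 (h.c'_nonneg T)
  have h2 : θ * b' T ≤ θ * 1 :=
    mul_le_mul_of_nonneg_left (by linarith [h.mass_le T, h.c'_nonneg T]) hθ0
  linarith

/-! ### Flow of a threshold policy -/

/-- The flow of a policy that reports every mismatch up to time `τ`, and afterwards only those in
which the monitored value is `s`. -/
structure IsThreshold (π : ℝ) (c b c' b' u : ℕ → ℝ) (τ : ℕ) : Prop where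
  c'_early : ∀ t, t + 1 ≤ τ → c' (t + 1) = π
  u_early : ∀ t, t + 1 ≤ τ → u (t + 1) = π - c (t + 1) + b (t + 1)
  c'_late : ∀ t, τ < t + 1 → c' (t + 1) = c (t + 1)
  u_late : ∀ t, τ < t + 1 → u (t + 1) = b (t + 1)
  b'_eq : ∀ t, b' (t + 1) = 0

lemma sum_mismatch_early (h : MismatchFlow p q π c b c' b' u) {τ : ℕ}
    (hτ : IsThreshold π c b c' b' u τ) (hκ : 0 ≤ q * π) (k : ℕ) (hk : k ≤ τ) :
    ∑ t ∈ Finset.range k, (π - c (t + 1) + b (t + 1)) ≤ 1 + 2 * (q * π) * k := by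
  induction k with
  | zero => simp
  | succ k ih =>
    rcases k with _ | k
    · have := h.mismatch_le 1
      simp
      linarith
    · have ih := ih (by omega)
      rw [Finset.sum_range_succ, h.c_succ (k + 1), h.b_succ (k + 1), hτ.b'_eq,
        hτ.c'_early k (by omega)]
      push_cast at ih ⊢
      linarith

/-- After the threshold, each late report uses up its probability from the mass of the monitored
value `s`, which is never replenished; this is why the late reports cost at most `1`. -/
lemma sum_mismatch_and_cost_le (h : MismatchFlow p q π c b c' b' u) {τ : ℕ}
    (hτ : IsThreshold π c b c' b' u τ) (hκ : 0 ≤ q * π) (k : ℕ) :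
    ∑ t ∈ Finset.range (τ + k), (π - c (t + 1) + b (t + 1)) + (c' (τ + k) + b' (τ + k))
        ≤ 2 + 2 * (q * π) * τ + π * k ∧
    ∑ t ∈ Finset.range (τ + k), u (t + 1) + (c' (τ + k) + b' (τ + k)) ≤ 2 + 2 * (q * π) * τ := by
  induction k with
  | zero =>
    have h1 := h.sum_mismatch_early hτ hκ τ le_rfl
    have h2 : ∑ t ∈ Finset.range τ, u (t + 1)
        = ∑ t ∈ Finset.range τ, (π - c (t + 1) + b (t + 1)) :=
      Finset.sum_congr rfl fun t ht => hτ.u_early t (Finset.mem_range.1 ht)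
    have h3 := h.mass_le τ
    constructor
    · simp only [add_zero, Nat.cast_zero, mul_zero]
      linarith
    · rw [add_zero, h2]
      linarith
  | succ k ih =>
    rw [show τ + (k + 1) = τ + k + 1 from rfl, Finset.sum_range_succ, Finset.sum_range_succ, hτ.b'_eq,
      hτ.c'_late _ (by omega), hτ.u_late _ (by omega)]
    have hm : c (τ + k + 1) + b (τ + k + 1) = c' (τ + k) + b' (τ + k) := by
      rw [h.c_succ, h.b_succ]; ring
    have := h.c_nonneg (τ + k + 1)
    push_cast
    constructor
    · linarith [ih.1]
    · linarith [ih.2]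

lemma sum_mismatch_le (h : MismatchFlow p q π c b c' b' u) {τ : ℕ}
    (hτ : IsThreshold π c b c' b' u τ) (hκ : 0 ≤ q * π) {L : ℕ} (hL : τ ≤ L) :
    ∑ t ∈ Finset.range L, (π - c (t + 1) + b (t + 1)) ≤ 2 + 2 * (q * π) * τ + π * (L - τ) := by
  obtain ⟨k, rfl⟩ := Nat.exists_eq_add_of_le hL
  have := (h.sum_mismatch_and_cost_le hτ hκ k).1
  have := h.c'_nonneg (τ + k)
  have := h.b'_nonneg (τ + k)
  push_cast
  linarith

lemma sum_cost_le (h : MismatchFlow p q π c b c' b' u) {τ : ℕ}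
    (hτ : IsThreshold π c b c' b' u τ) (hκ : 0 ≤ q * π) {T : ℕ} (hT : τ ≤ T) :
    ∑ t ∈ Finset.range T, u (t + 1) ≤ 2 + 2 * (q * π) * τ := by
  obtain ⟨k, rfl⟩ := Nat.exists_eq_add_of_le hT
  have := (h.sum_mismatch_and_cost_le hτ hκ k).2
  have := h.c'_nonneg (τ + k)
  have := h.b'_nonneg (τ + k)
  linarith

/-- Single-source comparison: every flow is matched, on a set of times `A` and up to additive
constants, by a threshold flow on the initial segment of the same length. -/
lemma exists_threshold (h : MismatchFlow p q π c b c' b' u) (hp : 0 ≤ p) (hpq : p ≤ q)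
    (hq0 : 0 < q) (hq : q < 1 / 2) (hπ : 0 ≤ π) (hπ1 : π ≤ 1) {T : ℕ} (A : Finset ℕ)
    (hA : A ⊆ Finset.range T) :
    ∃ τ ≤ T, ∀ d e d' e' s : ℕ → ℝ, MismatchFlow p q π d e d' e' s →
      IsThreshold π d e d' e' s τ →
      ∑ t ∈ Finset.range A.card, (π - d (t + 1) + e (t + 1))
          ≤ ∑ t ∈ A, (π - c (t + 1) + b (t + 1)) + 2 ∧
      ∑ t ∈ Finset.range T, s (t + 1) ≤ ∑ t ∈ Finset.range T, u (t + 1) + 5 := by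
  set L := A.card with hL
  set w := ∑ t ∈ Finset.range T, u (t + 1) with hw
  have hLT : L ≤ T := by simpa using Finset.card_le_card hA
  have hκ : 0 ≤ q * π := by positivity
  have hw0 : 0 ≤ w := Finset.sum_nonneg fun t _ => by
    linarith [h.cost (t + 1), h.c_le_c' (t + 1), h.b'_le_b (t + 1)]
  by_cases hc : 2 * (q * π) * L ≤ w + 3
  · refine ⟨L, hLT, fun d e d' e' s hd hτ => ⟨?_, ?_⟩⟩
    · have h1 := hd.sum_mismatch_le hτ hκ le_rfl
      have h2 : ∑ t ∈ A, 2 * (q * π) ≤ ∑ t ∈ A, (π - c (t + 1) + b (t + 1)) :=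
        Finset.sum_le_sum fun t _ => h.two_mul_le_mismatch (by linarith) hq t
      rw [Finset.sum_const, nsmul_eq_mul, ← hL] at h2
      linarith
    · linarith [hd.sum_cost_le hτ hκ hLT]
  · push Not at hc
    have hκ' : 0 < 2 * (q * π) := by
      rcases hκ.lt_or_eq with h0 | h0
      · linarith
      · rw [← h0] at hc
        simp at hc
        linarith
    -- the least threshold whose reports pay for the loss `2 θ` in `saving_le`
    set τ := ⌈(w + 2) / (2 * (q * π))⌉₊ with hτdef
    have hκ1 : 2 * (q * π) ≤ 1 := by nlinarith
    have t1 : w + 2 ≤ 2 * (q * π) * τ := by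
      have := Nat.le_ceil ((w + 2) / (2 * (q * π)))
      rwa [div_le_iff₀' hκ'] at this
    have t2 : 2 * (q * π) * τ ≤ w + 3 := by
      have := (Nat.ceil_lt_add_one (a := (w + 2) / (2 * (q * π))) (by positivity)).le
      have := mul_le_mul_of_nonneg_left this hκ'.le
      rw [mul_add, mul_div_cancel₀ _ hκ'.ne'] at this
      linarith
    have hτL : τ ≤ L := by
      have : (τ : ℝ) < L := lt_of_mul_lt_mul_left (t2.trans_lt hc) hκ'.le
      exact_mod_cast this.le
    refine ⟨τ, hτL.trans hLT, fun d e d' e' s hd hτ => ⟨?_, ?_⟩⟩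
    · have h1 := hd.sum_mismatch_le hτ hκ hτL
      set θ := (1 - 2 * q) / (2 * q) with hθdef
      have hθ : 2 * q * θ = 1 - 2 * q := by rw [hθdef]; field_simp
      have hθ0 : 0 ≤ θ := div_nonneg (by linarith) (by linarith)
      have h2 := h.saving_le hp hpq hq hθ hθ0 (fun t => if t - 1 ∈ A then 1 else 0)
        (fun t => by positivity) (fun t => by split_ifs <;> norm_num) T
      have h3 : ∑ t ∈ Finset.range T,
          (if t + 1 - 1 ∈ A then (1 : ℝ) else 0) * (c (t + 1) - b (t + 1))
          = ∑ t ∈ A, (c (t + 1) - b (t + 1)) := by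
        simp only [Nat.add_sub_cancel, ite_mul, one_mul, zero_mul]
        rw [← Finset.sum_filter, Finset.filter_mem_eq_inter, Finset.inter_eq_right.2 hA]
      have h4 : ∑ t ∈ A, (π - c (t + 1) + b (t + 1))
          = L * π - ∑ t ∈ A, (c (t + 1) - b (t + 1)) := by
        rw [hL, ← nsmul_eq_mul, ← Finset.sum_const, ← Finset.sum_sub_distrib]
        exact Finset.sum_congr rfl fun t _ => by ring
      rw [h3] at h2
      rw [h4]
      -- the saving per step of full reporting over freezing is `π - 2 q π = θ (2 q π)`
      have h5 : π - 2 * (q * π) = θ * (2 * (q * π)) := by linear_combination -π * hθ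
      have h6 := mul_le_mul_of_nonneg_left t1 hθ0
      have h7 : (τ : ℝ) * (π - 2 * (q * π)) = θ * (2 * (q * π) * τ) := by rw [h5]; ring
      nlinarith
    · linarith [hd.sum_cost_le hτ hκ (hτL.trans hLT)]

end MismatchFlow

/-! ### Expectations over the trajectories of one source -/

lemma bern_nonneg {p : ℝ} (h0 : 0 ≤ p) (h1 : p ≤ 1) (b : Bool) : 0 ≤ bern p b := by
  unfold bern; split_ifs <;> linarith

lemma sum_bern (p : ℝ) : ∑ b, bern p b = 1 := by simp [bern]

lemma sum_traj_succ {T : ℕ} (F : Traj (T + 1) → ℝ) :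
    ∑ ω, F ω = ∑ ω : Traj T, ∑ x : Bool, ∑ b : Bool,
      F (Fin.snoc (α := fun _ => Bool × Bool) ω (x, b)) := by
  rw [← (Fin.snocEquiv (fun _ : Fin (T + 2) => Bool × Bool)).sum_comp,
    Fintype.sum_prod_type_right]
  refine Finset.sum_congr rfl fun ω _ => ?_
  rw [Fintype.sum_prod_type]
  rfl

namespace Network

variable {N : ℕ} (S : Network N) (n : Fin N) (p : SourcePolicy)

/-- Expectation over the trajectories of the source `n` alone. -/
def sourceExpect (T : ℕ) (f : Traj T → ℝ) : ℝ := ∑ ω, S.pathWeight n p T ω * f ω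

lemma sourceExpect_add (T : ℕ) (f g : Traj T → ℝ) :
    S.sourceExpect n p T (fun ω => f ω + g ω)
      = S.sourceExpect n p T f + S.sourceExpect n p T g := by
  simp [sourceExpect, mul_add, Finset.sum_add_distrib]

lemma sourceExpect_sub (T : ℕ) (f g : Traj T → ℝ) :
    S.sourceExpect n p T (fun ω => f ω - g ω)
      = S.sourceExpect n p T f - S.sourceExpect n p T g := by
  simp [sourceExpect, mul_sub, Finset.sum_sub_distrib]

lemma stat_nonneg (a : Bool) : 0 ≤ S.stat n a := by
  have := S.mu_nonneg n
  have := S.lam_nonneg n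
  have := S.zeta_pos n
  exact bern_nonneg (by positivity) (div_le_one_of_le₀ (by linarith) (by linarith)) a

lemma trans_nonneg (b a : Bool) : 0 ≤ S.trans n b a := by
  have := S.mu_nonneg n
  have := S.lam_nonneg n
  have := S.mu_lt n
  have := S.lam_lt n
  refine bern_nonneg ?_ ?_ a <;> split_ifs <;> linarith

lemma pathWeight_nonneg (T : ℕ) (ω : Traj T) : 0 ≤ S.pathWeight n p T ω := by
  induction T with
  | zero => exact mul_nonneg (S.stat_nonneg n _) (bern_nonneg le_rfl zero_le_one _)
  | succ T ih =>
    exact mul_nonneg (mul_nonneg (ih _) (S.trans_nonneg n _ _))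
      (bern_nonneg (p _ _ _).2.1 (p _ _ _).2.2 _)

lemma sourceExpect_mono (T : ℕ) {f g : Traj T → ℝ} (h : ∀ ω, f ω ≤ g ω) :
    S.sourceExpect n p T f ≤ S.sourceExpect n p T g :=
  Finset.sum_le_sum fun ω _ => mul_le_mul_of_nonneg_left (h ω) (S.pathWeight_nonneg n p T ω)

lemma sourceExpect_nonneg (T : ℕ) {f : Traj T → ℝ} (h : ∀ ω, 0 ≤ f ω) :
    0 ≤ S.sourceExpect n p T f :=
  Finset.sum_nonneg fun ω _ => mul_nonneg (S.pathWeight_nonneg n p T ω) (h ω)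

lemma sourceExpect_zero (f : Traj 0 → ℝ) :
    S.sourceExpect n p 0 f = ∑ x, S.stat n x * f (fun _ => (x, false)) := by
  rw [sourceExpect, ← (Equiv.funUnique (Fin 1) (Bool × Bool)).symm.sum_comp,
    Fintype.sum_prod_type]
  refine Finset.sum_congr rfl fun x _ => ?_
  rw [Fintype.sum_bool]
  have h : (Equiv.funUnique (Fin 1) (Bool × Bool)).symm (x, false) = fun _ => (x, false) :=
    funext fun i => by rw [Subsingleton.elim i 0]; rfl
  simp only [h]
  simp [pathWeight, bern]

lemma sourceExpect_succ (T : ℕ) (f : Traj (T + 1) → ℝ) :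
    S.sourceExpect n p (T + 1) f = S.sourceExpect n p T (fun ω =>
      ∑ x, S.trans n (ω (Fin.last T)).1 x * ∑ b, bern (p (T + 1) ω x) b
        * f (Fin.snoc (α := fun _ => Bool × Bool) ω (x, b))) := by
  rw [sourceExpect, sum_traj_succ]
  refine Finset.sum_congr rfl fun ω _ => ?_
  simp only [pathWeight, Fin.init_snoc, Fin.snoc_last, Fin.snoc_castSucc, Finset.mul_sum]
  exact Finset.sum_congr rfl fun x _ => Finset.sum_congr rfl fun b _ => by ring

lemma sourceExpect_succ_of_init_state (T : ℕ) (g : Traj T → Bool → ℝ) :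
    S.sourceExpect n p (T + 1) (fun ω => g (Fin.init ω) (ω (Fin.last (T + 1))).1)
      = S.sourceExpect n p T (fun ω => ∑ x, S.trans n (ω (Fin.last T)).1 x * g ω x) := by
  rw [sourceExpect_succ]
  simp only [Fin.init_snoc, Fin.snoc_last, ← Finset.sum_mul, sum_bern, one_mul]

lemma sourceExpect_init (T : ℕ) (g : Traj T → ℝ) :
    S.sourceExpect n p (T + 1) (fun ω => g (Fin.init ω)) = S.sourceExpect n p T g := by
  rw [S.sourceExpect_succ_of_init_state n p T (fun ω _ => g ω)]
  have h (b : Bool) : ∑ x, S.trans n b x = 1 := sum_bern _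
  simp only [← Finset.sum_mul, h, one_mul]

/-- The law of a trajectory up to time `t` does not depend on the horizon. -/
lemma sourceExpect_restrict {t T : ℕ} (h : t ≤ T) (g : Traj t → ℝ) :
    S.sourceExpect n p T (fun ω => g (fun i => ω (i.castLE (by omega))))
      = S.sourceExpect n p t g := by
  induction T, h using Nat.le_induction with
  | base => rfl
  | succ T h ih => exact (S.sourceExpect_init n p T _).trans ih

lemma sourceExpect_initial_state (T : ℕ) (g : Bool → ℝ) :
    S.sourceExpect n p T (fun ω => g (ω 0).1) = ∑ x, S.stat n x * g x :=
  (S.sourceExpect_restrict n p (Nat.zero_le T) (fun ω => g (ω 0).1)).trans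
    (S.sourceExpect_zero n p _)

lemma sourceExpect_one (T : ℕ) : S.sourceExpect n p T (fun _ => 1) = 1 := by
  rw [S.sourceExpect_initial_state n p T (fun _ => 1)]
  simp only [mul_one]
  exact sum_bern _

/-- Under a deterministic policy only the trajectories that follow it matter. -/
lemma sourceExpect_congr_of_deterministic {T : ℕ} (D : (Fin (T + 1) → Bool × Bool) → Bool → Bool)
    (hD : ∀ h x, p (T + 1) h x = if D h x then 1 else 0) {f g : Traj (T + 1) → ℝ}
    (hfg : ∀ ω, (ω (Fin.last (T + 1))).2 = D (Fin.init ω) (ω (Fin.last (T + 1))).1 →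
      f ω = g ω) :
    S.sourceExpect n p (T + 1) f = S.sourceExpect n p (T + 1) g := by
  refine Finset.sum_congr rfl fun ω _ => ?_
  by_cases h : (ω (Fin.last (T + 1))).2 = D (Fin.init ω) (ω (Fin.last (T + 1))).1
  · rw [hfg ω h]
  · have : bern (p (T + 1) (Fin.init ω) (ω (Fin.last (T + 1))).1) (ω (Fin.last (T + 1))).2 = 0 := by
      rw [hD]
      revert h
      cases (ω (Fin.last (T + 1))).2 <;> cases D (Fin.init ω) (ω (Fin.last (T + 1))).1 <;>
        simp [bern]
    simp [pathWeight, this]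

/-! ### Joint law of the state and the monitored value -/

/-- The monitored value before the report made at the last time of the trajectory. -/
def valueBefore {t : ℕ} (ω : Traj t) : Bool :=
  monitored (S.start n) t (Fin.init ω) (ω (Fin.last t)).1

/-- The monitored value after the report made at the last time of the trajectory. -/
def valueAfter {t : ℕ} (ω : Traj t) : Bool :=
  if (ω (Fin.last t)).2 then (ω (Fin.last t)).1 else S.valueBefore n ω

/-- Joint law of the state and the monitored value at time `t`, before the report. -/
def pre (t : ℕ) (x y : Bool) : ℝ :=
  S.sourceExpect n p t fun ω => if (ω (Fin.last t)).1 = x ∧ S.valueBefore n ω = y then 1 else 0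

/-- Joint law of the state and the monitored value at time `t`, after the report. -/
def post (t : ℕ) (x y : Bool) : ℝ :=
  S.sourceExpect n p t fun ω => if (ω (Fin.last t)).1 = x ∧ S.valueAfter n ω = y then 1 else 0

/-- Probability of a report at time `t`. -/
def reportProb (t : ℕ) : ℝ :=
  S.sourceExpect n p t fun ω => if (ω (Fin.last t)).2 then 1 else 0

/-- Probability of a report at time `t` in the mismatch with state `x`. -/
def mismatchReportProb (t : ℕ) (x : Bool) : ℝ :=
  S.sourceExpect n p t fun ω =>
    if (ω (Fin.last t)).1 = x ∧ S.valueBefore n ω = !x ∧ (ω (Fin.last t)).2 then 1 else 0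

lemma pre_nonneg (t : ℕ) (x y : Bool) : 0 ≤ S.pre n p t x y :=
  S.sourceExpect_nonneg n p t fun ω => by split_ifs <;> norm_num

lemma post_nonneg (t : ℕ) (x y : Bool) : 0 ≤ S.post n p t x y :=
  S.sourceExpect_nonneg n p t fun ω => by split_ifs <;> norm_num

lemma mismatchReportProb_nonneg (t : ℕ) (x : Bool) : 0 ≤ S.mismatchReportProb n p t x :=
  S.sourceExpect_nonneg n p t fun ω => by split_ifs <;> norm_num

lemma pre_succ (t : ℕ) (x y : Bool) :
    S.pre n p (t + 1) x y = ∑ z, S.trans n z x * S.post n p t z y := by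
  have h1 : S.pre n p (t + 1) x y = S.sourceExpect n p t (fun ω =>
      ∑ z, S.trans n (ω (Fin.last t)).1 z
        * if z = x ∧ S.valueAfter n ω = y then 1 else 0) :=
    S.sourceExpect_succ_of_init_state n p t
      (fun ω z => if z = x ∧ S.valueAfter n ω = y then 1 else 0)
  rw [h1]
  simp only [post, sourceExpect, Finset.mul_sum]
  rw [Finset.sum_comm (s := Finset.univ (α := Bool))]
  refine Finset.sum_congr rfl fun ω _ => ?_
  cases (ω (Fin.last t)).1 <;> cases x <;> by_cases h : S.valueAfter n ω = y <;> simp [h, mul_comm]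

lemma post_match (t : ℕ) (x : Bool) :
    S.post n p t x x = S.pre n p t x x + S.mismatchReportProb n p t x := by
  rw [post, pre, mismatchReportProb, ← sourceExpect_add]
  congr 1
  funext ω
  rw [valueAfter]
  cases (ω (Fin.last t)).1 <;> cases (ω (Fin.last t)).2 <;> cases S.valueBefore n ω <;>
    cases x <;> simp

lemma post_mismatch (t : ℕ) (x : Bool) :
    S.post n p t x (!x) = S.pre n p t x (!x) - S.mismatchReportProb n p t x := by
  rw [post, pre, mismatchReportProb, ← sourceExpect_sub]
  congr 1
  funext ω
  rw [valueAfter]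
  cases (ω (Fin.last t)).1 <;> cases (ω (Fin.last t)).2 <;> cases S.valueBefore n ω <;>
    cases x <;> simp

lemma mismatchReportProb_add_le (t : ℕ) (x : Bool) :
    S.mismatchReportProb n p t x + S.mismatchReportProb n p t (!x) ≤ S.reportProb n p t := by
  rw [mismatchReportProb, mismatchReportProb, reportProb, ← sourceExpect_add]
  refine S.sourceExpect_mono n p t fun ω => ?_
  cases (ω (Fin.last t)).1 <;> cases (ω (Fin.last t)).2 <;> cases S.valueBefore n ω <;>
    cases x <;> simp

lemma post_add_post (t : ℕ) (x s : Bool) :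
    S.post n p t x s + S.post n p t x (!s) = S.pre n p t x s + S.pre n p t x (!s) := by
  have h1 := S.post_match n p t x
  have h2 := S.post_mismatch n p t x
  cases x <;> cases s <;> simp only [Bool.not_true, Bool.not_false] at h1 h2 ⊢ <;> linarith

lemma stat_stationary (x : Bool) : ∑ z, S.trans n z x * S.stat n z = S.stat n x := by
  have := (S.zeta_pos n).ne'
  cases x <;> simp [trans, stat, bern] <;> field_simp <;> ring

lemma pre_add_pre (t : ℕ) (x s : Bool) :
    S.pre n p t x s + S.pre n p t x (!s) = S.stat n x := by
  induction t generalizing x with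
  | zero =>
    rw [pre, pre, ← sourceExpect_add, sourceExpect_zero, Fintype.sum_bool]
    simp only [valueBefore, monitored]
    rcases Bool.eq_false_or_eq_true (S.start n true) with h1 | h1 <;>
      rcases Bool.eq_false_or_eq_true (S.start n false) with h2 | h2 <;>
      cases x <;> cases s <;> simp [h1, h2]
  | succ t ih =>
    rw [pre_succ, pre_succ, ← Finset.sum_add_distrib, ← S.stat_stationary n x]
    refine Finset.sum_congr rfl fun z _ => ?_
    rw [← mul_add, post_add_post, ih]

lemma stat_add_stat (s : Bool) : S.stat n s + S.stat n (!s) = 1 := by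
  cases s <;> simp [stat, bern]

/-- For each state `s`, the joint law of the state and the monitored value is governed by the mass
of the monitored value `s`. -/
lemma mismatchFlow (s : Bool) :
    MismatchFlow (S.trans n (!s) s) (S.trans n s (!s)) (S.stat n s)
      (fun t => S.pre n p t s s) (fun t => S.pre n p t (!s) s)
      (fun t => S.post n p t s s) (fun t => S.post n p t (!s) s) (S.reportProb n p) where
  c_succ t := by
    rw [pre_succ]
    cases s <;> simp [trans, bern]
    ring
  b_succ t := by
    rw [pre_succ]
    cases s <;> simp [trans, bern]
    ring
  c'_nonneg t := S.post_nonneg n p t s s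
  b'_nonneg t := S.post_nonneg n p t _ _
  c_nonneg t := S.pre_nonneg n p t _ _
  c'_le t := by
    have := S.post_add_post n p t s s
    have := S.pre_add_pre n p t s s
    have := S.post_nonneg n p t s (!s)
    linarith
  mass_le t := by
    have := S.post_add_post n p t s s
    have := S.pre_add_pre n p t s s
    have := S.post_nonneg n p t s (!s)
    have := S.post_add_post n p t (!s) s
    have := S.pre_add_pre n p t (!s) s
    have := S.post_nonneg n p t (!s) (!s)
    have := S.stat_add_stat n s
    linarith
  mismatch_le t := by
    have := S.pre_nonneg n p t s s
    have := S.pre_add_pre n p t (!s) s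
    have := S.pre_nonneg n p t (!s) (!s)
    have := S.stat_add_stat n s
    linarith
  c_le_c' t := by
    have := S.post_match n p t s
    have := S.mismatchReportProb_nonneg n p t s
    linarith
  b'_le_b t := by
    have := S.post_mismatch n p t (!s)
    have := S.mismatchReportProb_nonneg n p t (!s)
    simp only [Bool.not_not] at *
    linarith
  cost t := by
    have := S.post_match n p t s
    have := S.post_mismatch n p t (!s)
    have := S.mismatchReportProb_add_le n p t s
    simp only [Bool.not_not] at *
    linarith

/-- Probability of a mismatch at time `t`. -/
def mismatchProb (t : ℕ) : ℝ :=
  S.sourceExpect n p t fun ω => if (ω (Fin.last t)).1 ≠ S.valueBefore n ω then 1 else 0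

lemma mismatchProb_eq (s : Bool) (t : ℕ) :
    S.mismatchProb n p t = S.stat n s - S.pre n p t s s + S.pre n p t (!s) s := by
  have h : S.mismatchProb n p t = S.pre n p t s (!s) + S.pre n p t (!s) s := by
    rw [mismatchProb, pre, pre, ← sourceExpect_add]
    congr 1
    funext ω
    cases (ω (Fin.last t)).1 <;> cases S.valueBefore n ω <;> cases s <;> simp
  have := S.pre_add_pre n p t s s
  linarith

/-! ### Threshold policies -/

lemma thresholdPolicy_deterministic (τ : Fin N → ℕ) (s : Bool)
    (hs : s = decide (S.mu n ≤ S.lam n)) (t : ℕ) (h : Fin t → Bool × Bool) (x : Bool) :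
    S.thresholdPolicy τ n t h x =
      if decide (x ≠ monitored (S.start n) t h x ∧ (τ n < t → x = !s)) then 1 else 0 := by
  have h1 : τ n < t ↔ ¬ t ≤ τ n := by omega
  have h2 : S.lam n < S.mu n ↔ ¬ S.mu n ≤ S.lam n := not_le.symm
  simp only [thresholdPolicy, h1, h2]
  by_cases a : t ≤ τ n <;> by_cases b : S.mu n ≤ S.lam n <;> cases x <;>
    cases monitored (S.start n) t h _ <;> simp [a, b, hs]

lemma isThreshold_thresholdPolicy (τ : Fin N → ℕ) (s : Bool)
    (hs : s = decide (S.mu n ≤ S.lam n)) :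
    MismatchFlow.IsThreshold (S.stat n s)
      (fun t => S.pre n (S.thresholdPolicy τ n) t s s)
      (fun t => S.pre n (S.thresholdPolicy τ n) t (!s) s)
      (fun t => S.post n (S.thresholdPolicy τ n) t s s)
      (fun t => S.post n (S.thresholdPolicy τ n) t (!s) s)
      (S.reportProb n (S.thresholdPolicy τ n)) (τ n) := by
  set P := S.thresholdPolicy τ n with hP
  have hD (t : ℕ) {f g : Traj (t + 1) → ℝ}
      (hfg : ∀ ω, (ω (Fin.last (t + 1))).2 = decide
        ((ω (Fin.last (t + 1))).1 ≠ S.valueBefore n ω ∧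
          (τ n < t + 1 → (ω (Fin.last (t + 1))).1 = !s)) → f ω = g ω) :
      S.sourceExpect n P (t + 1) f = S.sourceExpect n P (t + 1) g :=
    S.sourceExpect_congr_of_deterministic n P
      (fun h x => decide (x ≠ monitored (S.start n) (t + 1) h x ∧ (τ n < t + 1 → x = !s)))
      (fun h x => S.thresholdPolicy_deterministic n τ s hs (t + 1) h x) hfg
  have hR1 (t : ℕ) : S.mismatchReportProb n P (t + 1) (!s) = S.pre n P (t + 1) (!s) s := by
    refine hD t fun ω h => ?_
    rw [h]
    cases (ω (Fin.last (t + 1))).1 <;> cases S.valueBefore n ω <;> cases s <;> simp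
  have hR2 (t : ℕ) (ht : t + 1 ≤ τ n) :
      S.mismatchReportProb n P (t + 1) s = S.pre n P (t + 1) s (!s) := by
    refine hD t fun ω h => ?_
    rw [h]
    cases (ω (Fin.last (t + 1))).1 <;> cases S.valueBefore n ω <;> cases s <;>
      simp [not_lt.2 ht]
  have hR3 (t : ℕ) (ht : τ n < t + 1) : S.mismatchReportProb n P (t + 1) s = 0 := by
    rw [mismatchReportProb, hD t (g := fun _ => 0)]
    · simp [sourceExpect]
    · intro ω h
      rw [h]
      cases (ω (Fin.last (t + 1))).1 <;> cases S.valueBefore n ω <;> cases s <;> simp [ht]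
  have hU (t : ℕ) : S.reportProb n P (t + 1)
      = S.mismatchReportProb n P (t + 1) s + S.mismatchReportProb n P (t + 1) (!s) := by
    rw [mismatchReportProb, mismatchReportProb, ← sourceExpect_add]
    refine hD t fun ω h => ?_
    rw [h]
    cases (ω (Fin.last (t + 1))).1 <;> cases S.valueBefore n ω <;> cases s <;> simp
  have hst (t : ℕ) := S.pre_add_pre n P t s s
  refine ⟨fun t ht => ?_, fun t ht => ?_, fun t ht => ?_, fun t ht => ?_, fun t => ?_⟩
  · linarith [S.post_match n P (t + 1) s, hR2 t ht, hst (t + 1)]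
  · linarith [hU t, hR2 t ht, hR1 t, hst (t + 1)]
  · linarith [S.post_match n P (t + 1) s, hR3 t ht]
  · linarith [hU t, hR3 t ht, hR1 t]
  · have := S.post_mismatch n P (t + 1) (!s)
    rw [Bool.not_not] at this
    linarith [hR1 t]

/-- Any policy of one source is matched, on a set of times `A` and up to absolute constants, by a
threshold policy on the initial segment of the same length. -/
lemma exists_threshold_comparison {T : ℕ} (A : Finset ℕ) (hA : A ⊆ Finset.range T) :
    ∃ τ₀ ≤ T, ∀ τ : Fin N → ℕ, τ n = τ₀ →
      ∑ t ∈ Finset.range A.card, S.mismatchProb n (S.thresholdPolicy τ n) (t + 1)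
          ≤ ∑ t ∈ A, S.mismatchProb n p (t + 1) + 2 ∧
      ∑ t ∈ Finset.range T, S.reportProb n (S.thresholdPolicy τ n) (t + 1)
          ≤ ∑ t ∈ Finset.range T, S.reportProb n p (t + 1) + 5 := by
  obtain ⟨s, hs⟩ : ∃ s, s = decide (S.mu n ≤ S.lam n) := ⟨_, rfl⟩
  have hz := S.zeta_pos n
  have hm := S.mu_lt n
  have hl := S.lam_lt n
  -- `s` is the state that is left at least as often as it is entered
  have hpq : S.trans n (!s) s ≤ S.trans n s (!s) ∧ 0 < S.trans n s (!s) ∧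
      S.trans n s (!s) < 1 / 2 := by
    by_cases h : S.mu n ≤ S.lam n
    · simp only [hs, h, trans, bern]
      norm_num
      exact ⟨h, by linarith, by linarith⟩
    · simp only [hs, h, trans, bern]
      norm_num
      push Not at h
      exact ⟨h.le, by linarith, by linarith⟩
  have hπ1 : S.stat n s ≤ 1 := by
    linarith [S.stat_add_stat n s, S.stat_nonneg n (!s)]
  obtain ⟨τ₀, h0, h⟩ := (S.mismatchFlow n p s).exists_threshold (S.trans_nonneg n _ _) hpq.1
    hpq.2.1 hpq.2.2 (S.stat_nonneg n s) hπ1 A hA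
  refine ⟨τ₀, h0, fun τ hτ => ?_⟩
  have := h _ _ _ _ _ (S.mismatchFlow n (S.thresholdPolicy τ n) s)
    (hτ ▸ S.isThreshold_thresholdPolicy n τ s hs)
  simpa only [← mismatchProb_eq] using this

end Network

namespace Network

variable {N : ℕ} (S : Network N)

/-! ### Independence of the sources -/

lemma expect_prod (T : ℕ) (U : UpdatePolicy N) (g : Fin N → Traj T → ℝ) :
    S.expect T U (fun ω => ∏ m, g m (ω m)) = ∏ m, S.sourceExpect m (U m) T (g m) := by
  simp only [expect, sourceExpect]
  rw [Finset.prod_univ_sum, Fintype.piFinset_univ]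
  simp only [Finset.prod_mul_distrib]

lemma expect_source (T : ℕ) (U : UpdatePolicy N) (n : Fin N) (g : Traj T → ℝ) :
    S.expect T U (fun ω => g (ω n)) = S.sourceExpect n (U n) T g := by
  have h := S.expect_prod T U (fun m ω => if m = n then g ω else 1)
  rw [Fintype.prod_eq_single n] at h
  · simpa using h
  · intro m hm
    simp [hm, sourceExpect_one]

lemma expect_initial_state (T : ℕ) (U : UpdatePolicy N) (F : (Fin N → Bool) → ℝ) :
    S.expect T U (fun ω => F (fun m => (ω m 0).1)) = ∑ x, F x * ∏ m, S.stat m (x m) := by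
  have h1 (x : Fin N → Bool) : ∏ m, S.stat m (x m) =
      S.expect T U (fun ω => ∏ m, if (ω m 0).1 = x m then 1 else 0) := by
    rw [S.expect_prod T U (fun m ω => if (ω 0).1 = x m then 1 else 0)]
    refine Finset.prod_congr rfl fun m _ => ?_
    rw [S.sourceExpect_initial_state m (U m) T (fun a => if a = x m then 1 else 0)]
    simp
  simp only [h1, expect, Finset.mul_sum]
  rw [Finset.sum_comm]
  refine Finset.sum_congr rfl fun ω _ => ?_
  rw [Finset.sum_eq_single (fun m => (ω m 0).1)]
  · simp [mul_comm]
  · intro x _ hx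
    obtain ⟨m, hm⟩ := Function.ne_iff.1 hx
    have h0 : ∏ m, (if (ω m 0).1 = x m then (1 : ℝ) else 0) = 0 :=
      Finset.prod_eq_zero (Finset.mem_univ m) (if_neg hm.symm)
    simp [h0]
  · simp

lemma expect_one (T : ℕ) (U : UpdatePolicy N) : S.expect T U (fun _ => 1) = 1 := by
  have h := S.expect_prod T U (fun _ _ => 1)
  simpa [sourceExpect_one] using h

lemma expect_mono (T : ℕ) (U : UpdatePolicy N) {f g : (Fin N → Traj T) → ℝ} (h : ∀ ω, f ω ≤ g ω) :
    S.expect T U f ≤ S.expect T U g :=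
  Finset.sum_le_sum fun ω _ => mul_le_mul_of_nonneg_left (h ω)
    (Finset.prod_nonneg fun m _ => S.pathWeight_nonneg m (U m) T _)

lemma alpha_nonneg (T : ℕ) (U : UpdatePolicy N) (n : Fin N) : 0 ≤ S.alpha T U n :=
  Finset.sum_nonneg fun ω _ => mul_nonneg
    (Finset.prod_nonneg fun m _ => S.pathWeight_nonneg m (U m) T _) (by dsimp only; split_ifs <;> norm_num)

lemma alpha_le_one (T : ℕ) (U : UpdatePolicy N) (n : Fin N) : S.alpha T U n ≤ 1 := by
  rw [← S.expect_one T U]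
  exact S.expect_mono T U fun ω => by split_ifs <;> norm_num

/-- The update policy does not influence the states. -/
lemma alpha_eq_alpha (T : ℕ) (U V : UpdatePolicy N) (n : Fin N) :
    S.alpha T U n = S.alpha T V n := by
  let F : (Fin N → Bool) → ℝ := fun x =>
    if (Finset.univ.filter (fun j : Fin N => j < n ∧ x j = true)).card < S.K then 1 else 0
  have h (W : UpdatePolicy N) :
      S.alpha T W n = S.expect T W (fun ω => F (fun m => (ω m 0).1)) := by
    unfold alpha prob
    refine congrArg (S.expect T W) (funext fun ω => ?_)
    by_cases h : (Finset.univ.filter (fun j : Fin N => j < n ∧ (ω j 0).1 = true)).card < S.K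
    · exact (if_pos h).trans (if_pos h).symm
    · exact (if_neg h).trans (if_neg h).symm
  rw [h, h, expect_initial_state, expect_initial_state]

lemma beta_eq (T : ℕ) (U : UpdatePolicy N) (n : Fin N) (t : Fin (T + 1)) :
    S.beta T U n t = S.mismatchProb n (U n) t := by
  rw [mismatchProb, ← S.sourceExpect_restrict n (U n) (Nat.lt_succ_iff.1 t.isLt), ← expect_source]
  simp only [beta, prob]
  congr!

lemma expect_report_eq (T : ℕ) (U : UpdatePolicy N) (n : Fin N) (t : Fin (T + 1)) :
    S.expect T U (report n t) = S.reportProb n (U n) t := by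
  rw [reportProb, ← S.sourceExpect_restrict n (U n) (Nat.lt_succ_iff.1 t.isLt), ← expect_source]
  rfl

/-! ### Existence of an optimal policy -/

lemma continuous_pathWeight (n : Fin N) (T : ℕ) (ω : Traj T) :
    Continuous fun p : SourcePolicy => S.pathWeight n p T ω := by
  induction T with
  | zero => exact continuous_const
  | succ T ih =>
    refine ((ih _).mul continuous_const).mul ?_
    have h : Continuous fun p : SourcePolicy =>
        ((p (T + 1) (Fin.init ω) (ω (Fin.last (T + 1))).1 : unitInterval) : ℝ) := by fun_prop
    cases (ω (Fin.last (T + 1))).2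
    · simp only [bern, Bool.false_eq_true, if_false]
      exact continuous_const.sub h
    · simpa [bern] using h

lemma continuous_expect (T : ℕ) (f : (Fin N → Traj T) → ℝ) :
    Continuous fun U : UpdatePolicy N => S.expect T U f :=
  continuous_finsetSum _ fun ω _ => (continuous_finsetProd _ fun n _ =>
    (S.continuous_pathWeight n T (ω n)).comp (continuous_apply n)).mul continuous_const

lemma continuous_rate (T : ℕ) : Continuous fun U : UpdatePolicy N => S.rate T U :=
  continuous_const.mul (continuous_finsetSum _ fun _ _ => continuous_finsetSum _ fun _ _ =>
    S.continuous_expect T _)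

lemma rho_eq_inf' (h : (Finset.univ : Finset (Fin N)).Nonempty) (T : ℕ) (U : UpdatePolicy N)
    (t : Fin (T + 1)) :
    S.rho T U t = Finset.univ.inf' h fun m =>
      S.alpha T U m + ∑ n ∈ Finset.univ.filter (· < m), S.alpha T U n * S.beta T U n t :=
  have := Finset.univ_nonempty_iff.1 h
  (Finset.inf'_univ_eq_ciInf _).symm

lemma continuous_avgRho (hN : 0 < N) (T : ℕ) :
    Continuous fun U : UpdatePolicy N => S.avgRho T U := by
  have hne : (Finset.univ : Finset (Fin N)).Nonempty := ⟨⟨0, hN⟩, Finset.mem_univ _⟩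
  refine continuous_const.mul (continuous_finsetSum _ fun t _ => ?_)
  simp only [S.rho_eq_inf' hne]
  exact Continuous.finset_inf'_apply hne fun m _ => (S.continuous_expect T _).add
    (continuous_finsetSum _ fun n _ => (S.continuous_expect T _).mul (S.continuous_expect T _))

lemma rate_eq (T : ℕ) (U : UpdatePolicy N) :
    S.rate T U = (1 / (T : ℝ)) * ∑ n, ∑ t ∈ Finset.range T, S.reportProb n (U n) (t + 1) := by
  simp only [rate, expect_report_eq, Fin.val_succ]
  congr 2
  funext n
  exact Fin.sum_univ_eq_sum_range (fun t => S.reportProb n (U n) (t + 1)) T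

lemma exists_rate_eq_zero (T : ℕ) : ∃ U : UpdatePolicy N, S.rate T U = 0 := by
  refine ⟨fun _ _ _ _ => 0, ?_⟩
  have h (n : Fin N) (t : ℕ) : S.reportProb n (fun _ _ _ => 0) (t + 1) = 0 := by
    rw [reportProb, S.sourceExpect_congr_of_deterministic n _ (fun _ _ => false) (by simp)
      (g := fun _ => 0) (by intro ω h; simp [h])]
    simp [sourceExpect]
  simp [rate_eq, h]

lemma exists_isOptimal (hN : 0 < N) (T : ℕ) {r : ℝ} (hr : 0 < r) :
    ∃ U : UpdatePolicy N, S.IsOptimal T r U := by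
  obtain ⟨U₀, h₀⟩ := S.exists_rate_eq_zero T
  have hc : IsCompact {U : UpdatePolicy N | S.rate T U ≤ r} :=
    (isClosed_le (S.continuous_rate T) continuous_const).isCompact
  obtain ⟨U, hU, hmin⟩ := hc.exists_isMinOn ⟨U₀, by simpa [h₀] using hr.le⟩
    (S.continuous_avgRho hN T).continuousOn
  exact ⟨U, hU, fun V hV => hmin hV⟩

/-! ### Rearrangement of the cut-off levels -/

lemma rho_le (T : ℕ) (U : UpdatePolicy N) (t : Fin (T + 1)) (m : Fin N) :
    S.rho T U t
      ≤ S.alpha T U m + ∑ n ∈ Finset.univ.filter (· < m), S.alpha T U n * S.beta T U n t :=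
  ciInf_le (Finite.bddBelow_range _) m

lemma exists_rho_eq (hN : 0 < N) (T : ℕ) (U : UpdatePolicy N) (t : Fin (T + 1)) :
    ∃ m, S.rho T U t
      = S.alpha T U m + ∑ n ∈ Finset.univ.filter (· < m), S.alpha T U n * S.beta T U n t := by
  have : Nonempty (Fin N) := ⟨⟨0, hN⟩⟩
  obtain ⟨m, hm⟩ := exists_eq_ciInf_of_finite (f := fun m : Fin N =>
    S.alpha T U m + ∑ n ∈ Finset.univ.filter (· < m), S.alpha T U n * S.beta T U n t)
  exact ⟨m, hm.symm⟩

/-- The times at which the source `n` lies above the cut-off level `m`. -/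
def activeTimes {T : ℕ} (m : Fin T → Fin N) (n : Fin N) : Finset ℕ :=
  (Finset.univ.filter fun t => n < m t).map Fin.valEmbedding

lemma activeTimes_subset {T : ℕ} (m : Fin T → Fin N) (n : Fin N) :
    activeTimes m n ⊆ Finset.range T := by
  intro t ht
  obtain ⟨s, _, rfl⟩ := Finset.mem_map.1 ht
  exact Finset.mem_range.2 s.isLt

lemma sum_cutoff_eq {T : ℕ} (a : Fin N → ℝ) (β : Fin N → ℕ → ℝ) (m : Fin T → Fin N) :
    ∑ t : Fin T, (a (m t) + ∑ n ∈ Finset.univ.filter (· < m t), a n * β n t)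
      = ∑ t, a (m t) + ∑ n, a n * ∑ t ∈ activeTimes m n, β n t := by
  rw [Finset.sum_add_distrib]
  congr 1
  simp only [activeTimes, Finset.sum_map, Finset.mul_sum, Finset.sum_filter, mul_ite, mul_zero]
  rw [Finset.sum_comm]
  rfl

/-- For a nonincreasing level, the source `n` is active on an initial segment. -/
lemma activeTimes_of_antitone {T : ℕ} {m : Fin T → Fin N} (hm : Antitone m) (n : Fin N) :
    activeTimes m n = Finset.range (activeTimes m n).card := by
  have hlow : ∀ s t, s ≤ t → t ∈ activeTimes m n → s ∈ activeTimes m n := by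
    intro s t hst ht
    obtain ⟨t', ht', rfl⟩ := Finset.mem_map.1 ht
    refine Finset.mem_map.2 ⟨⟨s, lt_of_le_of_lt hst t'.isLt⟩, ?_, rfl⟩
    refine Finset.mem_filter.2 ⟨Finset.mem_univ _, (Finset.mem_filter.1 ht').2.trans_le (hm ?_)⟩
    simpa [Fin.le_def] using hst
  refine Finset.eq_of_subset_of_card_le (fun t ht => Finset.mem_range.2 ?_) (by simp)
  have : Finset.range (t + 1) ⊆ activeTimes m n := fun s hs =>
    hlow s t (Nat.lt_succ_iff.1 (Finset.mem_range.1 hs)) ht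
  simpa using Finset.card_le_card this

lemma card_activeTimes_comp {T : ℕ} (m : Fin T → Fin N) (σ : Equiv.Perm (Fin T)) (n : Fin N) :
    (activeTimes (m ∘ σ) n).card = (activeTimes m n).card := by
  simp only [activeTimes, Finset.card_map]
  exact Finset.card_equiv σ (by simp)

lemma exists_antitone_comp_perm {T : ℕ} (m : Fin T → Fin N) :
    ∃ σ : Equiv.Perm (Fin T), Antitone (m ∘ σ) :=
  ⟨Tuple.sort (OrderDual.toDual ∘ m), Tuple.monotone_sort (OrderDual.toDual ∘ m)⟩

/-- Comparison with an arbitrary policy, with the constant `5`. -/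
lemma exists_thresholdPolicy_le (hN : 0 < N) {T : ℕ} (U : UpdatePolicy N) :
    ∃ τ : Fin N → ℕ, (∀ n, τ n ≤ T) ∧
      S.avgRho T (S.thresholdPolicy τ) ≤ S.avgRho T U + 5 * ((N : ℝ) / T) ∧
      S.rate T (S.thresholdPolicy τ) ≤ S.rate T U + 5 * ((N : ℝ) / T) := by
  choose m hm using fun t : Fin T => S.exists_rho_eq hN T U t.succ
  obtain ⟨σ, hσ⟩ := exists_antitone_comp_perm m
  choose τ hτT hτ using fun n =>
    S.exists_threshold_comparison n (U n) (activeTimes m n) (activeTimes_subset m n)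
  have hτ' (n : Fin N) := hτ n τ rfl
  have hT0 : (0 : ℝ) ≤ 1 / T := by positivity
  refine ⟨τ, hτT, ?_, ?_⟩
  · set V := S.thresholdPolicy τ with hV
    have h1 : ∑ t : Fin T, S.rho T V t.succ ≤ ∑ t, S.alpha T U (m t)
        + ∑ n, S.alpha T U n * ∑ t ∈ Finset.range (activeTimes m n).card,
          S.mismatchProb n (V n) (t + 1) := by
      calc ∑ t : Fin T, S.rho T V t.succ
          ≤ ∑ t : Fin T, (S.alpha T U ((m ∘ σ) t) + ∑ n ∈ Finset.univ.filter (· < (m ∘ σ) t),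
              S.alpha T U n * S.mismatchProb n (V n) (t + 1)) := by
            refine Finset.sum_le_sum fun t _ => (S.rho_le T V t.succ ((m ∘ σ) t)).trans_eq ?_
            simp only [beta_eq, S.alpha_eq_alpha T V U, Fin.val_succ]
        _ = _ := by
            rw [sum_cutoff_eq _ (fun n t => S.mismatchProb n (V n) (t + 1))]
            congr 1
            · exact Equiv.sum_comp σ (fun t => S.alpha T U (m t))
            · refine Finset.sum_congr rfl fun n _ => ?_
              rw [activeTimes_of_antitone hσ, card_activeTimes_comp]
    have h2 : ∑ t : Fin T, S.rho T U t.succ = ∑ t, S.alpha T U (m t)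
        + ∑ n, S.alpha T U n * ∑ t ∈ activeTimes m n, S.mismatchProb n (U n) (t + 1) := by
      rw [← sum_cutoff_eq _ (fun n t => S.mismatchProb n (U n) (t + 1))]
      refine Finset.sum_congr rfl fun t _ => (hm t).trans ?_
      simp only [beta_eq, Fin.val_succ]
    have h3 : ∑ n, S.alpha T U n * ∑ t ∈ Finset.range (activeTimes m n).card,
          S.mismatchProb n (V n) (t + 1)
        ≤ ∑ n, (S.alpha T U n * ∑ t ∈ activeTimes m n, S.mismatchProb n (U n) (t + 1) + 5) := by
      refine Finset.sum_le_sum fun n _ => ?_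
      have := mul_le_mul_of_nonneg_left (hτ' n).1 (S.alpha_nonneg T U n)
      linarith [S.alpha_le_one T U n]
    rw [Finset.sum_add_distrib, Finset.sum_const, Finset.card_univ, Fintype.card_fin,
      nsmul_eq_mul] at h3
    calc S.avgRho T V ≤ 1 / T * (∑ t : Fin T, S.rho T U t.succ + N * 5) :=
          mul_le_mul_of_nonneg_left (by linarith) hT0
      _ = _ := by rw [avgRho]; ring
  · have h := Finset.sum_le_sum fun (n : Fin N) (_ : n ∈ Finset.univ) => (hτ' n).2
    rw [Finset.sum_add_distrib, Finset.sum_const, Finset.card_univ, Fintype.card_fin,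
      nsmul_eq_mul] at h
    calc S.rate T (S.thresholdPolicy τ)
        ≤ 1 / T * (∑ n, ∑ t ∈ Finset.range T, S.reportProb n (U n) (t + 1) + N * 5) := by
          rw [rate_eq]
          exact mul_le_mul_of_nonneg_left h hT0
      _ = _ := by rw [rate_eq]; ring

end Network

end

theorem theorem2 :
    ∃ C : ℝ, ∀ (N T : ℕ), 0 < N → 0 < T → ∀ (S : Network N) (r : ℝ), 0 < r →
      (∃ U : UpdatePolicy N, S.IsOptimal T r U) ∧
      ∀ U : UpdatePolicy N, S.IsOptimal T r U →
        ∃ τ : Fin N → ℕ, (∀ n, τ n ≤ T) ∧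
          S.avgRho T (S.thresholdPolicy τ) ≤ S.avgRho T U + C * ((N : ℝ) / T) ∧
          S.rate T (S.thresholdPolicy τ) ≤ r + C * ((N : ℝ) / T) := by
  refine ⟨5, fun N T hN _ S r hr => ⟨S.exists_isOptimal hN T hr, fun U hU => ?_⟩⟩
  obtain ⟨τ, hτ, h1, h2⟩ := S.exists_thresholdPolicy_le hN (T := T) U
  exact ⟨τ, hτ, h1, by linarith [hU.1]⟩
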